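/- Let $n,m\ge 1$, let $A_1,\dots,A_m\in\mathbb R^{n\times n}$, and let $G=(V,E)$ be a finite directed graph with arcs labelled by $[m]=\{1,\dots,m\}$, i.e. $V$ is a finite set and $E\subseteq V\times V\times[m]$ is nonempty, $(u,v,\sigma)\in E$ being an arc from $u$ to $v$ with label $\sigma$. Let $\mathbb S^{n-1}$ be the Euclidean unit sphere of $\mathbb R^n$, let $\mathcal F$ be the space of continuous functions $f:\mathbb R^n\to\mathbb R$ that are positively homogeneous of degree one ($f(cx)=c\,f(x)$ for all $c\ge 0$), and let $\mathcal F_{++}$ be the set of those $f\in\mathcal F$ with $f(x)>0$ for all $x\neq 0$. For a finite Borel measure $\mu$ on $\mathbb S^{n-1}$ and a matrix $M$, let $M_\#\mu$ be the finite Borel measure on $\mathbb S^{n-1}$ given by $$(M_\#\mu)(B)=\int_{\{x\in\mathbb S^{n-1}\,:\,Mx\ne0,\ Mx/\|Mx\|\in B\}}\|Mx\|\,d\mu(x),$$ so that $\int f\,d(M_\#\mu)=\int f(Mx)\,d\mu(x)$ for all $f\in\mathcal F$. For $\gamma\in\mathbb R$, the primal (Lyapunov) program is feasible for $\gamma$ if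 there are functions $f_v\in\mathcal F_{++}$ ($v\in V$) with $$f_v(A_\sigma x)\le\gamma f_u(x)\quad\text{for all }(u,v,\sigma)\in E,\ x\in\mathbb R^n,\qquad \sum_{v\in V}\int_{\mathbb S^{n-1}}f_v(x)\,dx=1,$$ and the dual program is feasible for $\gamma$ if there are finite nonnegative Borel measures $\mu_{uv\sigma}$ on $\mathbb S^{n-1}$ ($(u,v,\sigma)\in E$) with $$\sum_{(u,v,\sigma)\in E}(A_\sigma)_\#\mu_{uv\sigma}\ \ge\ \gamma\sum_{(v,w,\sigma)\in E}\mu_{vw\sigma}\quad\text{for all }v\in V,\qquad \sum_{(u,v,\sigma)\in E}\mu_{uv\sigma}(\mathbb S^{n-1})=1.$$ Then, for every $\gamma\in\mathbb R$: - (Weak duality) If the primal is feasible for $\gamma$, then the dual is infeasible for every $\gamma'>\gamma$. If the dual is feasible for $\gamma$, then the primal is infeasible for every $\gamma'<\gamma$. - (Strong duality) If the primal is infeasible for $\gamma$, then the dual is feasible for $\gamma$. If the dual is infeasible for $\gamma$, then the primal is feasible for $\gamma$. Moreover, there is a real number $\gamma^*$ such that the primal is feasible for every $\gamma>\gamma^*$,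 the dual is feasible for every $\gamma<\gamma^*$, and at least one of the two programs is feasible for $\gamma=\gamma^*$. -/

import Mathlib

open MeasureTheory

noncomputable section

/-- The Euclidean space `ℝⁿ`. -/
abbrev Eucl (n : ℕ) : Type := EuclideanSpace ℝ (Fin n)

/-- The unit sphere `S^{n-1}` of `ℝⁿ`. -/
abbrev USphere (n : ℕ) : Type := Metric.sphere (0 : Eucl n) 1

/-- The linear action `x ↦ M x` of a matrix on `ℝⁿ`. -/
def act {n : ℕ} (M : Matrix (Fin n) (Fin n) ℝ) : Eucl n →L[ℝ] Eucl n :=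
  Matrix.toEuclideanCLM (𝕜 := ℝ) M

/-- The space `F` of continuous functions on `ℝⁿ` that are positively homogeneous of degree one. -/
def homFun (n : ℕ) : Set (Eucl n → ℝ) :=
  {f | Continuous f ∧ ∀ c : ℝ, 0 ≤ c → ∀ x, f (c • x) = c * f x}

/-- The set `F₊₊` of strictly positive functions of `F` (positive away from the origin). -/
def posHomFun (n : ℕ) : Set (Eucl n → ℝ) :=
  {f | f ∈ homFun n ∧ ∀ x, x ≠ 0 → 0 < f x}

/-- The push-forward of a measure `μ` on the sphere by a matrix `M`, as a measure on the sphere: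
a unit of mass at `x` is sent to the mass `‖M x‖` at the point `M x / ‖M x‖` (and is lost if
`M x = 0`). It is the adjoint of `f ↦ f ∘ M` on `F`, see `integral_pushSphere`. -/
def pushSphere {n : ℕ} (M : Matrix (Fin n) (Fin n) ℝ) (μ : Measure (USphere n)) :
    Measure (USphere n) :=
  ((μ.withDensity fun x : USphere n => ENNReal.ofReal ‖act M (x : Eucl n)‖).map
    fun x : USphere n => ‖act M (x : Eucl n)‖⁻¹ • act M (x : Eucl n)).comap Subtype.val

/-- The defining property of the push-forward: `⟨M_# μ, f⟩ = ⟨μ, f ∘ M⟩` for `f ∈ F`. -/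
theorem integral_pushSphere {n : ℕ} (M : Matrix (Fin n) (Fin n) ℝ) (μ : Measure (USphere n))
    {f : Eucl n → ℝ} (hf : f ∈ homFun n) :
    ∫ y, f (y : Eucl n) ∂(pushSphere M μ) = ∫ x, f (act M (x : Eucl n)) ∂μ := by
  obtain ⟨hc, hh⟩ := hf
  have hA : Measurable fun x : USphere n => act M (x : Eucl n) := by
    have : Continuous fun x : USphere n => act M (x : Eucl n) := by fun_prop
    exact this.measurable
  have hw : Measurable fun x : USphere n => ‖act M (x : Eucl n)‖ := hA.norm
  have hp : Measurable fun x : USphere n => ‖act M (x : Eucl n)‖⁻¹ • act M (x : Eucl n) :=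
    hw.inv.smul hA
  have hs : MeasurableSet (Metric.sphere (0 : Eucl n) 1) := Metric.isClosed_sphere.measurableSet
  rw [pushSphere, integral_subtype_comap hs (fun y => f y), ← integral_indicator hs,
    integral_map hp.aemeasurable
      ((hc.measurable.indicator hs).aestronglyMeasurable),
    integral_withDensity_eq_integral_toReal_smul hw.ennreal_ofReal (by simp)]
  refine integral_congr_ae (Filter.Eventually.of_forall fun x => ?_)
  simp only [ENNReal.toReal_ofReal (norm_nonneg _), smul_eq_mul]
  by_cases h0 : act M (x : Eucl n) = 0
  · have : f 0 = 0 := by simpa using hh 0 le_rfl 0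
    simp [h0, this]
  · have hn : ‖act M (x : Eucl n)‖ ≠ 0 := norm_ne_zero_iff.mpr h0
    rw [Set.indicator_of_mem, hh _ (by positivity), ← mul_assoc, mul_inv_cancel₀ hn, one_mul]
    rw [mem_sphere_zero_iff_norm, norm_smul, norm_inv, norm_norm, inv_mul_cancel₀ hn]

/-- Feasibility of the Lyapunov program for a fixed `γ`. The automaton has node set `V` and arc set
`E`; the triple `(u, v, σ) ∈ E` is an arc from `u` to `v` with label `σ`, and `A σ` is the matrix
of the label `σ`. The integrals are with respect to the surface measure of the sphere. -/
def PrimalFeasible {V : Type*} [Fintype V] {n m : ℕ} (E : Finset (V × V × Fin m))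
    (A : Fin m → Matrix (Fin n) (Fin n) ℝ) (γ : ℝ) : Prop :=
  ∃ f : V → Eucl n → ℝ,
    (∀ v, f v ∈ posHomFun n) ∧
    (∀ u v σ, (u, v, σ) ∈ E → ∀ x : Eucl n, f v (act (A σ) x) ≤ γ * f u x) ∧
    ∑ v, ∫ x : USphere n, f v (x : Eucl n) ∂(volume : Measure (Eucl n)).toSphere = 1

/-- Feasibility of the dual program for a fixed `γ`: there is a family of finite (nonnegative) Borel
measures on the sphere, one for each arc, of total mass one, such that at each node `v` the sum of
the push-forwards of the measures of the arcs entering `v` is at least `γ` times the sum of the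
measures of the arcs leaving `v`, as (signed, since `γ` may be negative) measures. -/
def DualFeasible {V : Type*} [DecidableEq V] {n m : ℕ} (E : Finset (V × V × Fin m))
    (A : Fin m → Matrix (Fin n) (Fin n) ℝ) (γ : ℝ) : Prop :=
  ∃ μ : E → Measure (USphere n),
    (∀ e, IsFiniteMeasure (μ e)) ∧
    (∀ v : V, ∀ B : Set (USphere n), MeasurableSet B →
      γ * ∑ e : E with e.1.1 = v, (μ e).real B ≤
        ∑ e : E with e.1.2.1 = v, (pushSphere (A e.1.2.2) (μ e)).real B) ∧
    ∑ e : E, (μ e).real Set.univ = 1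

end

/-! Weak duality is a pairing: integrating `f_v` against the dual inequality at `v`, summing over
nodes and applying the Lyapunov inequality on each arc gives `γ' * S ≤ γ * S` with `S > 0`
(`PrimalFeasible.le_of_dualFeasible`).

Strong duality is a theorem of the alternative. If the primal fails at `γ`, no `f` makes every slack
`γ f_u - f_v ∘ A_σ` and every `f_v` strictly positive on the sphere. Hahn–Banach then separates the
range of `constraintMap` from the open cone of positive families, and Riesz–Markov–Kakutani turns
the separating functional into measures on arcs and nodes. The arc measures, normalised, are dual
feasible; the node measures are the slack in the dual inequalities. Primal feasibility is monotone
in `γ`, so the threshold is the infimum of the feasible values. -/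

/-! ### Separation and representation by measures on a compact space. -/

/-- Riesz–Markov–Kakutani on a compact space, for a nonnegative linear functional. -/
theorem exists_finite_measure_of_nonneg_functional {X : Type*} [TopologicalSpace X] [T2Space X]
    [CompactSpace X] [MeasurableSpace X] [BorelSpace X] (L : C(X, ℝ) →ₗ[ℝ] ℝ)
    (hL : ∀ g : C(X, ℝ), (∀ x, 0 ≤ g x) → 0 ≤ L g) :
    ∃ μ : Measure X, IsFiniteMeasure μ ∧ ∀ g : C(X, ℝ), ∫ x, g x ∂μ = L g := by
  let T : CompactlySupportedContinuousMap X ℝ →ₗ[ℝ] ℝ :=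
    { toFun := fun g => L g.toContinuousMap
      map_add' := fun f g => L.map_add f.toContinuousMap g.toContinuousMap
      map_smul' := fun c g => L.map_smul c g.toContinuousMap }
  let Λ := PositiveLinearMap.mk₀ T (fun g hg => hL _ (CompactlySupportedContinuousMap.le_def.1 hg))
  have hreg : IsFiniteMeasureOnCompacts (RealRMK.rieszMeasure Λ) := inferInstance
  refine ⟨RealRMK.rieszMeasure Λ, ⟨isCompact_univ.measure_lt_top⟩, fun g => ?_⟩
  exact RealRMK.integral_rieszMeasure Λ (CompactlySupportedContinuousMap.continuousMapEquiv g)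

/-- Theorem of the alternative: if no element of the range of `T` is strictly positive everywhere,
then some nonzero family of finite measures annihilates the range of `T`. -/
theorem exists_measures_annihilating_range {X ι W : Type*} [TopologicalSpace X] [T2Space X]
    [CompactSpace X] [MeasurableSpace X] [BorelSpace X] [Fintype ι]
    [AddCommGroup W] [Module ℝ W] (T : W →ₗ[ℝ] (ι → C(X, ℝ)))
    (hT : ∀ w, ¬ ∀ i x, 0 < T w i x) :
    ∃ μ : ι → Measure X, (∀ i, IsFiniteMeasure (μ i)) ∧ 0 < ∑ i, (μ i).real Set.univ ∧
      ∀ w, ∑ i, ∫ x, T w i x ∂(μ i) = 0 := by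
  classical
  let P : Set (ι → C(X, ℝ)) := {g | ∀ i x, 0 < g i x}
  have hPc : Convex ℝ P := by
    intro g hg h hh a b ha hb hab i x
    have h1 := hg i x
    have h2 := hh i x
    simp only [Pi.add_apply, Pi.smul_apply, ContinuousMap.add_apply, ContinuousMap.smul_apply,
      smul_eq_mul]
    rcases ha.lt_or_eq with h | h
    · have := mul_pos h h1
      have := mul_nonneg hb h2.le
      linarith
    · have : b = 1 := by linarith
      simp [← h, this, h2]
  have hPo : IsOpen P := by
    have : P = ⋂ i, (fun g : ι → C(X, ℝ) => g i) ⁻¹' {g | Set.MapsTo g Set.univ (Set.Ioi 0)} := by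
      ext g; simp [P, Set.MapsTo]
    rw [this]
    exact isOpen_iInter_of_finite fun i =>
      (ContinuousMap.isOpen_setOfPred_mapsTo isCompact_univ isOpen_Ioi).preimage (continuous_apply i)
  have hdis : Disjoint P (LinearMap.range T : Set (ι → C(X, ℝ))) := by
    rw [Set.disjoint_left]
    rintro _ hg ⟨w, rfl⟩
    exact hT w hg
  obtain ⟨φ, u, hu, hφ⟩ := geometric_hahn_banach_open hPc hPo
    (LinearMap.range T).convex hdis
  have hu0 : u ≤ 0 := by simpa using hφ 0 (LinearMap.range T).zero_mem
  have hφT : ∀ w, φ (T w) = 0 := by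
    intro w
    by_contra hne
    -- A functional bounded below by `u` on a subspace vanishes there: otherwise some multiple takes
    -- the value `u - 1`.
    have h1 := hφ (T (((u - 1) / φ (T w)) • w)) ⟨_, rfl⟩
    rw [map_smul, map_smul, smul_eq_mul, div_mul_cancel₀ _ hne] at h1
    linarith
  have hnonneg : ∀ g : ι → C(X, ℝ), (∀ i x, 0 ≤ g i x) → φ g ≤ 0 := by
    intro g hg
    -- A nonnegative family is a limit of the strictly positive families `g + ε • 1`, on which `φ <
    -- u ≤ 0`.
    have key : ∀ ε : ℝ, 0 < ε → φ g + ε * φ 1 ≤ 0 := by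
      intro ε hε
      have : g + ε • 1 ∈ P := fun i x => by
        have := hg i x
        simp; linarith
      have := hu _ this
      rw [map_add, map_smul, smul_eq_mul] at this
      linarith
    by_contra! hpos
    -- This `ε` keeps `ε * |φ 1|` at most `φ g / 2`, too small to cancel `φ g`.
    have h1 := key (φ g / (2 * (|φ 1| + 1))) (by positivity)
    have h2 : φ g / (2 * (|φ 1| + 1)) * |φ 1| ≤ φ g / 2 := by
      rw [div_mul_eq_mul_div, div_le_div_iff₀ (by positivity) (by norm_num)]
      nlinarith
    have h3 : φ g / (2 * (|φ 1| + 1)) * -|φ 1| ≤ φ g / (2 * (|φ 1| + 1)) * φ 1 :=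
      mul_le_mul_of_nonneg_left (neg_abs_le _) (by positivity)
    linarith
  -- The positive cone lies on the negative side of `φ`, so it is `-φ`, restricted to each
  -- coordinate, that is represented by a measure.
  choose μ hμf hμ using fun i => exists_finite_measure_of_nonneg_functional
    (-(φ.toLinearMap ∘ₗ LinearMap.single ℝ (fun _ : ι => C(X, ℝ)) i)) (by
      intro g hg
      have := hnonneg (Pi.single i g) (fun j x => by
        by_cases h : j = i
        · subst h; simpa using hg x
        · simp [h])
      simpa using this)
  have hsum : ∀ g : ι → C(X, ℝ), ∑ i, ∫ x, g i x ∂(μ i) = - φ g := by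
    intro g
    have : g = ∑ i, Pi.single i (g i) := (Finset.univ_sum_single g).symm
    conv_rhs => rw [this, map_sum]
    simp [hμ]
  refine ⟨μ, hμf, ?_, fun w => by rw [hsum, hφT, neg_zero]⟩
  have h1 := hsum 1
  simp only [Pi.one_apply, ContinuousMap.one_apply, integral_const, smul_eq_mul, mul_one] at h1
  rw [h1]
  have := hu 1 (fun i x => by simp)
  linarith

/-! ### Passing between inequalities on sets and on integrals. -/

theorem measureReal_finsetSum {X ι : Type*} [MeasurableSpace X] (s : Finset ι)
    (μ : ι → Measure X) [∀ i, IsFiniteMeasure (μ i)] (B : Set X) :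
    (∑ i ∈ s, μ i).real B = ∑ i ∈ s, (μ i).real B := by
  simp only [Measure.real, Measure.finsetSum_apply]
  exact ENNReal.toReal_sum fun i _ => measure_ne_top _ _

/-- For `γ ≥ 0` both sides of the hypothesis are integrals against finite measures, which continuous
functions determine; dropping `ν ≥ 0` leaves the inequality. For `γ ≤ 0` the signs alone suffice,
which avoids signed measures. -/
theorem mul_sum_measureReal_le_of_integral_eq {X ι κ : Type*} [TopologicalSpace X]
    [CompactSpace X] [MeasurableSpace X] [BorelSpace X] [HasOuterApproxClosed X]
    {s : Finset ι} {t : Finset κ} {μ : ι → Measure X} {η : κ → Measure X} {ν : Measure X}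
    [∀ i, IsFiniteMeasure (μ i)] [∀ j, IsFiniteMeasure (η j)] [IsFiniteMeasure ν] {γ : ℝ}
    (h : ∀ g : C(X, ℝ),
      ∑ j ∈ t, ∫ x, g x ∂(η j) = γ * ∑ i ∈ s, ∫ x, g x ∂(μ i) + ∫ x, g x ∂ν) (B : Set X) :
    γ * ∑ i ∈ s, (μ i).real B ≤ ∑ j ∈ t, (η j).real B := by
  rcases le_total γ 0 with hγ | hγ
  · exact (mul_nonpos_of_nonpos_of_nonneg hγ (by positivity)).trans (by positivity)
  lift γ to NNReal using hγ
  have hint : ∀ (ρ : Measure X) [IsFiniteMeasure ρ] (g : C(X, ℝ)), Integrable g ρ := fun ρ _ g =>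
    g.continuous.integrable_of_hasCompactSupport (HasCompactSupport.of_compactSpace g)
  have heq : ∑ j ∈ t, η j = γ • ∑ i ∈ s, μ i + ν := by
    refine ext_of_forall_integral_eq_of_IsFiniteMeasure fun g => ?_
    have := h g.toContinuousMap
    have hg := fun (ρ : Measure X) [IsFiniteMeasure ρ] => hint ρ g.toContinuousMap
    simp only [BoundedContinuousFunction.coe_toContinuousMap] at this hg
    rw [integral_finsetSum_measure fun j _ => hg _, this,
      integral_add_measure (hg _) (hg _), integral_smul_nnreal_measure,
      integral_finsetSum_measure fun i _ => hg _]
    rfl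
  have h2 := congrArg (fun ρ => ρ.real B) heq
  rw [measureReal_finsetSum, measureReal_add_apply (measure_ne_top _ _) (measure_ne_top _ _),
    measureReal_nnreal_smul_apply, measureReal_finsetSum] at h2
  rw [h2]
  exact le_add_of_nonneg_right measureReal_nonneg

theorem mul_sum_integral_le_of_measureReal_le {X ι κ : Type*} [TopologicalSpace X]
    [CompactSpace X] [MeasurableSpace X] [BorelSpace X]
    {s : Finset ι} {t : Finset κ} {μ : ι → Measure X} {η : κ → Measure X}
    [∀ i, IsFiniteMeasure (μ i)] [∀ j, IsFiniteMeasure (η j)] {γ : ℝ}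
    (h : ∀ B, MeasurableSet B → γ * ∑ i ∈ s, (μ i).real B ≤ ∑ j ∈ t, (η j).real B)
    {g : X → ℝ} (hg : Continuous g) (hg0 : ∀ x, 0 ≤ g x) :
    γ * ∑ i ∈ s, ∫ x, g x ∂(μ i) ≤ ∑ j ∈ t, ∫ x, g x ∂(η j) := by
  rcases le_total γ 0 with hγ | hγ
  · exact (mul_nonpos_of_nonpos_of_nonneg hγ
      (Finset.sum_nonneg fun i _ => integral_nonneg hg0)).trans
      (Finset.sum_nonneg fun i _ => integral_nonneg hg0)
  lift γ to NNReal using hγ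
  have hint : ∀ (ρ : Measure X) [IsFiniteMeasure ρ], Integrable g ρ := fun ρ _ =>
    hg.integrable_of_hasCompactSupport (HasCompactSupport.of_compactSpace g)
  have hle : γ • ∑ i ∈ s, μ i ≤ ∑ j ∈ t, η j := by
    refine Measure.le_iff.2 fun B hB => ?_
    rw [← ENNReal.toReal_le_toReal (measure_ne_top _ _) (measure_ne_top _ _)]
    change (γ • ∑ i ∈ s, μ i).real B ≤ (∑ j ∈ t, η j).real B
    simpa [measureReal_finsetSum] using h B hB
  have h1 := integral_mono_measure hle (Filter.Eventually.of_forall hg0) (hint _)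
  rwa [integral_smul_nnreal_measure, integral_finsetSum_measure fun i _ => hint _,
    integral_finsetSum_measure fun i _ => hint _] at h1

/-! ### Positively homogeneous functions and their restrictions to the sphere. -/

theorem homFun_zero {n : ℕ} {f : Eucl n → ℝ} (hf : f ∈ homFun n) : f 0 = 0 := by
  simpa using hf.2 0 le_rfl 0

theorem homFun_eq_norm_mul {n : ℕ} {f : Eucl n → ℝ} (hf : f ∈ homFun n) {x : Eucl n}
    (hx : x ≠ 0) :
    ∃ y : USphere n, x = ‖x‖ • (y : Eucl n) ∧ f x = ‖x‖ * f y := by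
  have hn : ‖x‖ ≠ 0 := norm_ne_zero_iff.2 hx
  have hxy : x = ‖x‖ • (‖x‖⁻¹ • x) := by rw [smul_smul, mul_inv_cancel₀ hn, one_smul]
  refine ⟨⟨‖x‖⁻¹ • x, by simp [norm_smul, hn]⟩, hxy, ?_⟩
  conv_lhs => rw [hxy, hf.2 _ (norm_nonneg _)]

/-- The positively homogeneous functions, as a vector space. -/
def homFunSubmodule (n : ℕ) : Submodule ℝ (Eucl n → ℝ) where
  carrier := homFun n
  add_mem' hf hg := ⟨hf.1.add hg.1, fun c hc x => by
    simp only [Pi.add_apply, hf.2 c hc, hg.2 c hc, mul_add]⟩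
  zero_mem' := ⟨continuous_const, fun c _ x => by simp⟩
  smul_mem' a f hf := ⟨hf.1.const_smul a, fun c hc x => by
    simp only [Pi.smul_apply, hf.2 c hc, smul_eq_mul]; ring⟩

theorem comp_act_mem_homFun {n : ℕ} {f : Eucl n → ℝ} (hf : f ∈ homFun n)
    (M : Matrix (Fin n) (Fin n) ℝ) : (fun x => f (act M x)) ∈ homFun n :=
  ⟨hf.1.comp (act M).continuous, fun c hc x => by simp only [map_smul, hf.2 c hc]⟩

theorem norm_mem_posHomFun (n : ℕ) : (fun x : Eucl n => ‖x‖) ∈ posHomFun n :=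
  ⟨⟨continuous_norm, fun c hc x => by
    simp only [norm_smul, Real.norm_of_nonneg hc]⟩,
    fun _ hx => norm_pos_iff.2 hx⟩

/-- Every continuous function on the sphere extends to a positively homogeneous function. -/
theorem exists_homFun_extension {n : ℕ} (g : C(USphere n, ℝ)) :
    ∃ f ∈ homFun n, ∀ x : USphere n, f x = g x := by
  classical
  let p : ∀ x : Eucl n, x ≠ 0 → USphere n := fun x hx =>
    ⟨‖x‖⁻¹ • x, by simp [norm_smul, norm_ne_zero_iff.2 hx]⟩
  let f : Eucl n → ℝ := fun x => if hx : x = 0 then 0 else ‖x‖ * g (p x hx)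
  have hf0 : f 0 = 0 := by simp [f]
  have hf : ∀ x (hx : x ≠ 0), f x = ‖x‖ * g (p x hx) := fun x hx => by simp [f, hx]
  refine ⟨f, ⟨continuous_iff_continuousAt.2 fun x => ?_, fun c hc x => ?_⟩, fun x => ?_⟩
  · by_cases hx : x = 0
    · subst hx
      -- The direction has no limit at the origin, but `g` is bounded, so the factor `‖y‖` forces
      -- continuity.
      have hb : ∀ y, ‖f y‖ ≤ ‖y‖ * ‖g‖ := fun y => by
        by_cases hy : y = 0
        · simp [hy, hf0]
        · rw [hf y hy, norm_mul, norm_norm]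
          exact mul_le_mul_of_nonneg_left (g.norm_coe_le_norm _) (norm_nonneg _)
      rw [ContinuousAt, hf0]
      refine squeeze_zero_norm hb ?_
      have : Continuous fun y : Eucl n => ‖y‖ * ‖g‖ := by fun_prop
      simpa using this.tendsto 0
    · have hc : ContinuousOn f {0}ᶜ := by
        rw [continuousOn_iff_continuous_domRestrict]
        have : Set.domRestrict {0}ᶜ f = fun y : ({0}ᶜ : Set (Eucl n)) => ‖(y : Eucl n)‖ * g (p y y.2) :=
          funext fun y => hf y y.2
        rw [this]
        refine (continuous_subtype_val.norm).mul (g.continuous.comp (Continuous.subtype_mk ?_ _))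
        exact (continuous_subtype_val.norm.inv₀ fun y => norm_ne_zero_iff.2 y.2).smul
          continuous_subtype_val
      exact hc.continuousAt (isOpen_compl_singleton.mem_nhds hx)
  · by_cases hx : x = 0
    · simp [hx, hf0]
    rcases hc.eq_or_lt with rfl | hc
    · simp [hf0]
    have hcx : c • x ≠ 0 := smul_ne_zero hc.ne' hx
    have hp : p (c • x) hcx = p x hx := by
      ext1
      simp only [p, norm_smul, Real.norm_of_nonneg hc.le, smul_smul]
      congr 1
      field_simp
    rw [hf _ hcx, hf _ hx, hp, norm_smul, Real.norm_of_nonneg hc.le, mul_assoc]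
  · have hx1 : ‖(x : Eucl n)‖ = 1 := by simp
    have hx0 : (x : Eucl n) ≠ 0 := norm_ne_zero_iff.1 (by simp)
    have hp : p x hx0 = x := by ext1; simp [p]
    rw [hf _ hx0, hp, hx1, one_mul]

theorem integrable_sphere {n : ℕ} {f : Eucl n → ℝ} (hf : Continuous f)
    (μ : Measure (USphere n)) [IsFiniteMeasure μ] : Integrable (fun x : USphere n => f x) μ :=
  (hf.comp continuous_subtype_val).integrable_of_hasCompactSupport
    (HasCompactSupport.of_compactSpace _)

instance isFiniteMeasure_pushSphere {n : ℕ} (M : Matrix (Fin n) (Fin n) ℝ)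
    (μ : Measure (USphere n)) [IsFiniteMeasure μ] : IsFiniteMeasure (pushSphere M μ) := by
  have hi : Integrable (fun x : USphere n => ‖act M (x : Eucl n)‖) μ :=
    integrable_sphere (f := fun x => ‖act M x‖) (by fun_prop) μ
  have := isFiniteMeasure_withDensity_ofReal hi.2
  refine ⟨?_⟩
  rw [pushSphere, Measure.comap_apply₀]
  · exact measure_lt_top _ _
  · exact Subtype.val_injective
  · intro s hs
    exact (Metric.isClosed_sphere.measurableSet.subtype_image hs).nullMeasurableSet
  · exact MeasurableSet.univ.nullMeasurableSet

theorem integral_sphere_pos {n : ℕ} {f : Eucl n → ℝ} (hf : f ∈ posHomFun n)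
    {μ : Measure (USphere n)} [IsFiniteMeasure μ] (hμ : μ ≠ 0) :
    0 < ∫ x : USphere n, f (x : Eucl n) ∂μ := by
  have hpos : ∀ x : USphere n, 0 < f x := fun x => hf.2 x (norm_ne_zero_iff.1 (by simp))
  rw [integral_pos_iff_support_of_nonneg (fun x => (hpos x).le) (integrable_sphere hf.1.1 μ)]
  have : Function.support (fun x : USphere n => f (x : Eucl n)) = Set.univ :=
    Set.eq_univ_of_forall fun x => (hpos x).ne'
  rw [this]
  exact (Measure.measure_univ_ne_zero.2 hμ).bot_lt

theorem posHomFun_nonneg {n : ℕ} {f : Eucl n → ℝ} (hf : f ∈ posHomFun n) (x : Eucl n) :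
    0 ≤ f x := by
  rcases eq_or_ne x 0 with rfl | hx
  · rw [homFun_zero hf.1]
  · exact (hf.2 x hx).le

/-! ### The two programs and their duality. -/

section Programs

variable {V : Type*} [Fintype V] {n m : ℕ} {E : Finset (V × V × Fin m)}
  {A : Fin m → Matrix (Fin n) (Fin n) ℝ} {γ : ℝ}

/-- The arc inequalities survive positive scaling, so the normalisation is free once the total
integral is positive; `1 ≤ n` makes the surface measure nonzero. -/
theorem primalFeasible_of_exists [Nonempty V] (hn : 1 ≤ n) (f : V → Eucl n → ℝ)
    (hf : ∀ v, f v ∈ posHomFun n)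
    (hE : ∀ u v σ, (u, v, σ) ∈ E → ∀ x : Eucl n, f v (act (A σ) x) ≤ γ * f u x) :
    PrimalFeasible E A γ := by
  have : NeZero n := ⟨by omega⟩
  set I := ∑ v, ∫ x : USphere n, f v (x : Eucl n) ∂(volume : Measure (Eucl n)).toSphere with hI
  have hIpos : 0 < I := Finset.sum_pos
    (fun v _ => integral_sphere_pos (hf v) (Measure.toSphere_ne_zero _)) Finset.univ_nonempty
  refine ⟨fun v x => I⁻¹ * f v x, fun v => ⟨⟨(hf v).1.1.const_mul _, fun c hc x => ?_⟩,
    fun x hx => mul_pos (inv_pos.2 hIpos) ((hf v).2 x hx)⟩, fun u v σ h x => ?_, ?_⟩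
  · simp only [(hf v).1.2 c hc]; ring
  · have := mul_le_mul_of_nonneg_left (hE u v σ h x) (inv_pos.2 hIpos).le
    linarith
  · simp only [integral_const_mul]
    rw [← Finset.mul_sum, ← hI, inv_mul_cancel₀ hIpos.ne']

theorem PrimalFeasible.mono {γ' : ℝ} (h : PrimalFeasible E A γ) (hγ : γ ≤ γ') :
    PrimalFeasible E A γ' := by
  obtain ⟨f, hf, hE, h1⟩ := h
  exact ⟨f, hf, fun u v σ h x => (hE u v σ h x).trans
    (mul_le_mul_of_nonneg_right hγ (posHomFun_nonneg (hf u) x)), h1⟩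

theorem PrimalFeasible.nonneg (hn : 1 ≤ n) (hE : E.Nonempty) (h : PrimalFeasible E A γ) :
    0 ≤ γ := by
  have : NeZero n := ⟨by omega⟩
  obtain ⟨f, hf, hA, -⟩ := h
  obtain ⟨⟨u, v, σ⟩, he⟩ := hE
  obtain ⟨x, hx⟩ := exists_ne (0 : Eucl n)
  have h1 := (posHomFun_nonneg (hf v) _).trans (hA u v σ he x)
  exact nonneg_of_mul_nonneg_left h1 ((hf u).2 x hx)

theorem exists_primalFeasible [Nonempty V] (hn : 1 ≤ n) (E : Finset (V × V × Fin m))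
    (A : Fin m → Matrix (Fin n) (Fin n) ℝ) : ∃ γ, PrimalFeasible E A γ := by
  -- The Euclidean norm at every node works for any `γ` dominating all operator norms.
  refine ⟨∑ σ, ‖act (A σ)‖, primalFeasible_of_exists hn (fun _ x => ‖x‖)
    (fun _ => norm_mem_posHomFun n) fun u v σ _ x => ?_⟩
  refine ((act (A σ)).le_opNorm x).trans (mul_le_mul_of_nonneg_right ?_ (norm_nonneg x))
  exact Finset.single_le_sum (f := fun σ => ‖act (A σ)‖) (fun _ _ => norm_nonneg _)
    (Finset.mem_univ σ)

/-- The constraint operator of the primal program: its components are the slacks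
`γ f_u - f_v ∘ A_σ` of the arcs and the functions `f_v` of the nodes. -/
noncomputable def constraintMap (E : Finset (V × V × Fin m)) (A : Fin m → Matrix (Fin n) (Fin n) ℝ) (γ : ℝ) :
    (V → homFunSubmodule n) →ₗ[ℝ] (E ⊕ V → C(USphere n, ℝ)) where
  toFun f := Sum.elim
    (fun e => ⟨fun x => γ * (f e.1.1).1 x - (f e.1.2.1).1 (act (A e.1.2.2) x),
      ((((f e.1.1).2.1).const_mul γ).sub (comp_act_mem_homFun (f e.1.2.1).2 _).1).comp
        continuous_subtype_val⟩)
    (fun v => ⟨fun x => (f v).1 x, (f v).2.1.comp continuous_subtype_val⟩)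
  map_add' f g := by
    ext i x
    rcases i with e | v
    · simp; ring
    · simp
  map_smul' c f := by
    ext i x
    rcases i with e | v
    · simp; ring
    · simp

theorem primalFeasible_of_constraintMap_pos [Nonempty V] (hn : 1 ≤ n)
    {f : V → homFunSubmodule n} (hf : ∀ i x, 0 < constraintMap E A γ f i x) :
    PrimalFeasible E A γ := by
  refine primalFeasible_of_exists hn (fun v => (f v).1) (fun v => ⟨(f v).2, fun x hx => ?_⟩)
    fun u v σ he x => ?_
  · obtain ⟨y, -, hy⟩ := homFun_eq_norm_mul (f v).2 hx
    rw [hy]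
    exact mul_pos (norm_pos_iff.2 hx) (hf (Sum.inr v) y)
  · rcases eq_or_ne x 0 with rfl | hx
    · simp [homFun_zero (f u).2, homFun_zero (f v).2]
    · obtain ⟨y, hxy, hy⟩ := homFun_eq_norm_mul (f u).2 hx
      have h2 : (f v).1 (act (A σ) x) = ‖x‖ * (f v).1 (act (A σ) y) := by
        conv_lhs => rw [hxy, map_smul, (f v).2.2 _ (norm_nonneg _)]
      have h3 : 0 < γ * (f u).1 y - (f v).1 (act (A σ) y) := hf (Sum.inl ⟨(u, v, σ), he⟩) y
      rw [h2, hy]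
      nlinarith [norm_nonneg x]

variable [DecidableEq V]

theorem PrimalFeasible.le_of_dualFeasible {γ' : ℝ} (hp : PrimalFeasible E A γ)
    (hd : DualFeasible E A γ') : γ' ≤ γ := by
  obtain ⟨f, hf, hA, -⟩ := hp
  obtain ⟨μ, hμ, hle, h1⟩ := hd
  have hv : ∀ v, γ' * ∑ e : E with e.1.1 = v, ∫ x : USphere n, f v x ∂(μ e) ≤
      ∑ e : E with e.1.2.1 = v, ∫ x : USphere n, f v (act (A e.1.2.2) x) ∂(μ e) := fun v => by
    have := mul_sum_integral_le_of_measureReal_le (hle v)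
      (g := fun x : USphere n => f v x) ((hf v).1.1.comp continuous_subtype_val)
      (fun x => posHomFun_nonneg (hf v) _)
    simpa only [integral_pushSphere _ _ (hf v).1] using this
  have hsum := Finset.sum_le_sum fun v (_ : v ∈ Finset.univ) => hv v
  have hout : ∑ v, ∑ e : E with e.1.1 = v, ∫ x : USphere n, f v x ∂(μ e) =
      ∑ e : E, ∫ x : USphere n, f e.1.1 x ∂(μ e) := by
    rw [← Finset.sum_fiberwise (Finset.univ : Finset E) (fun e => e.1.1)]
    refine Finset.sum_congr rfl fun v _ => Finset.sum_congr rfl fun e he => ?_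
    rw [(Finset.mem_filter.1 he).2]
  have hin : ∑ v, ∑ e : E with e.1.2.1 = v,
        ∫ x : USphere n, f v (act (A e.1.2.2) x) ∂(μ e) =
      ∑ e : E, ∫ x : USphere n, f e.1.2.1 (act (A e.1.2.2) x) ∂(μ e) := by
    rw [← Finset.sum_fiberwise (Finset.univ : Finset E) (fun e => e.1.2.1)]
    refine Finset.sum_congr rfl fun v _ => Finset.sum_congr rfl fun e he => ?_
    rw [(Finset.mem_filter.1 he).2]
  rw [← Finset.mul_sum, hout, hin] at hsum
  have hle2 : ∑ e : E, ∫ x : USphere n, f e.1.2.1 (act (A e.1.2.2) x) ∂(μ e) ≤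
      γ * ∑ e : E, ∫ x : USphere n, f e.1.1 x ∂(μ e) := by
    rw [Finset.mul_sum]
    refine Finset.sum_le_sum fun e _ => ?_
    rw [← integral_const_mul]
    exact integral_mono (integrable_sphere (comp_act_mem_homFun (hf _).1 _).1 _)
      ((integrable_sphere (hf _).1.1 _).const_mul _) fun x => hA _ _ _ e.2 x
  have hpos : 0 < ∑ e : E, ∫ x : USphere n, f e.1.1 x ∂(μ e) := by
    obtain ⟨e, -, he⟩ := Finset.exists_ne_zero_of_sum_ne_zero (h1.trans_ne one_ne_zero)
    -- Total mass one forces some arc measure to be nonzero, and `f` is strictly positive on the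
    -- sphere.
    refine Finset.sum_pos' (fun e _ => integral_nonneg fun x => posHomFun_nonneg (hf _) _)
      ⟨e, Finset.mem_univ e, integral_sphere_pos (hf _) ?_⟩
    rintro h0
    simp [h0] at he
  exact le_of_mul_le_mul_right (hsum.trans hle2) hpos

theorem dualFeasible_of_not_primalFeasible [Nonempty V] (hn : 1 ≤ n)
    (h : ¬ PrimalFeasible E A γ) : DualFeasible E A γ := by
  obtain ⟨μ, hμf, hμpos, hμ⟩ := exists_measures_annihilating_range (constraintMap E A γ)
    fun f hf => h (primalFeasible_of_constraintMap_pos hn hf)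
  simp only [Fintype.sum_sum_type] at hμpos hμ
  have hann : ∀ f : V → homFunSubmodule n,
      ∑ e : E, ∫ x : USphere n, (γ * (f e.1.1).1 x - (f e.1.2.1).1 (act (A e.1.2.2) x))
        ∂(μ (Sum.inl e)) + ∑ v, ∫ x : USphere n, (f v).1 x ∂(μ (Sum.inr v)) = 0 := hμ
  set M := ∑ e : E, (μ (Sum.inl e)).real Set.univ with hM
  -- The alternative could give mass to nodes only. Testing against the norm at every node, which is
  -- `1` on the sphere, would then make the total node mass zero.
  have hMpos : 0 < M := by
    refine (Finset.sum_nonneg fun _ _ => measureReal_nonneg).lt_of_ne fun h0 => ?_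
    have h0e : ∀ e, μ (Sum.inl e) = 0 := fun e => by
      have := (Finset.sum_eq_zero_iff_of_nonneg fun _ _ => measureReal_nonneg).1 h0.symm e
        (Finset.mem_univ e)
      simpa [measureReal_eq_zero_iff] using this
    have h2 := hann fun _ => ⟨_, (norm_mem_posHomFun n).1⟩
    simp [h0e] at h2
    rw [hM, ← h0, zero_add] at hμpos
    exact hμpos.ne' h2
  have hb : ∀ (v : V) (g : C(USphere n, ℝ)),
      ∑ e : E with e.1.2.1 = v, ∫ x, g x ∂(pushSphere (A e.1.2.2) (μ (Sum.inl e))) =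
        γ * ∑ e : E with e.1.1 = v, ∫ x, g x ∂(μ (Sum.inl e)) + ∫ x, g x ∂(μ (Sum.inr v)) := by
    intro v g
    obtain ⟨f, hf, hfg⟩ := exists_homFun_extension g
    simp only [← hfg, integral_pushSphere _ _ hf]
    -- A family supported at the single node `v` isolates the balance at `v`: outgoing arcs
    -- contribute the `γ` term, incoming arcs the push-forwards, and a loop both.
    have h1 := hann (Pi.single v ⟨f, hf⟩)
    have hs : ∀ w, ((Pi.single v ⟨f, hf⟩ : V → homFunSubmodule n) w).1 =
        if w = v then f else 0 := fun w => by
      rcases eq_or_ne w v with rfl | hw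
      · simp
      · simp [hw]
    simp only [hs] at h1
    have h2 : ∀ e : E, ∫ x : USphere n, (γ * (if e.1.1 = v then f else 0) x -
        (if e.1.2.1 = v then f else 0) (act (A e.1.2.2) x)) ∂(μ (Sum.inl e)) =
        γ * (if e.1.1 = v then ∫ x : USphere n, f x ∂(μ (Sum.inl e)) else 0) -
        (if e.1.2.1 = v then ∫ x : USphere n, f (act (A e.1.2.2) x) ∂(μ (Sum.inl e)) else 0) := by
      intro e
      have i1 := integrable_sphere hf.1 (μ (Sum.inl e))
      have i2 := integrable_sphere (comp_act_mem_homFun hf (A e.1.2.2)).1 (μ (Sum.inl e))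
      split_ifs
      · rw [integral_sub (i1.const_mul γ) i2, integral_const_mul]
      · simp [integral_const_mul]
      · simp [integral_neg]
      · simp
    have h3 : ∑ w, ∫ x : USphere n, (if w = v then f else 0) x ∂(μ (Sum.inr w)) =
        ∫ x : USphere n, f x ∂(μ (Sum.inr v)) := by
      rw [Finset.sum_eq_single v] <;> simp +contextual
    rw [h3, Finset.sum_congr rfl fun e _ => h2 e, Finset.sum_sub_distrib, ← Finset.mul_sum,
      ← Finset.sum_filter, ← Finset.sum_filter] at h1
    linarith
  refine ⟨fun e => (M⁻¹).toNNReal • μ (Sum.inl e), fun e => inferInstance, fun v B _ => ?_, ?_⟩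
  · refine mul_sum_measureReal_le_of_integral_eq (ν := (M⁻¹).toNNReal • μ (Sum.inr v))
      (fun g => ?_) B
    obtain ⟨f, hf, hfg⟩ := exists_homFun_extension g
    have := congrArg (fun t => (M⁻¹).toNNReal • t) (hb v g)
    simp only [← hfg, integral_pushSphere _ _ hf, integral_smul_nnreal_measure,
      ← Finset.smul_sum] at this ⊢
    rw [this, smul_add, mul_smul_comm]
  · simp only [measureReal_nnreal_smul_apply]
    rw [← Finset.mul_sum, ← hM, Real.coe_toNNReal _ (inv_pos.2 hMpos).le,
      inv_mul_cancel₀ hMpos.ne']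

end Programs

theorem mainTheorem6 {V : Type*} [Fintype V] [DecidableEq V] {n m : ℕ} (hn : 1 ≤ n)
    (E : Finset (V × V × Fin m)) (hE : E.Nonempty) (A : Fin m → Matrix (Fin n) (Fin n) ℝ) :
    (∀ γ : ℝ,
      ((PrimalFeasible E A γ → ∀ γ' : ℝ, γ < γ' → ¬ DualFeasible E A γ') ∧
        (DualFeasible E A γ → ∀ γ' : ℝ, γ' < γ → ¬ PrimalFeasible E A γ')) ∧
      ((¬ PrimalFeasible E A γ → DualFeasible E A γ) ∧
        (¬ DualFeasible E A γ → PrimalFeasible E A γ))) ∧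
    ∃ γs : ℝ,
      (∀ γ : ℝ, γs < γ → PrimalFeasible E A γ) ∧
      (∀ γ : ℝ, γ < γs → DualFeasible E A γ) ∧
      (PrimalFeasible E A γs ∨ DualFeasible E A γs) := by
  have : Nonempty V := ⟨hE.choose.1⟩
  have strong : ∀ γ, ¬ PrimalFeasible E A γ → DualFeasible E A γ :=
    fun γ => dualFeasible_of_not_primalFeasible hn
  refine ⟨fun γ => ⟨⟨fun hp γ' hγ hd => ?_, fun hd γ' hγ hp => ?_⟩, strong γ,
    not_imp_comm.1 (strong γ)⟩, sInf {γ | PrimalFeasible E A γ}, fun γ hγ => ?_, fun γ hγ => ?_,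
    or_iff_not_imp_left.2 (strong _)⟩
  · exact (hp.le_of_dualFeasible hd).not_gt hγ
  · exact (hp.le_of_dualFeasible hd).not_gt hγ
  · obtain ⟨γ', h', hlt⟩ := exists_lt_of_csInf_lt (exists_primalFeasible hn E A) hγ
    exact PrimalFeasible.mono h' hlt.le
  -- A nonempty arc set forces feasible values to be nonnegative, so the infimum is a genuine lower
  -- bound.
  · exact strong γ fun hp => (csInf_le ⟨0, fun _ h => PrimalFeasible.nonneg hn hE h⟩ hp).not_gt hγ
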